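/- Let $f:\mathbb{R}^n\to[0,\infty)$ be a surface tension, i.e. convex and positively $1$-homogeneous, whose Wulff shape $K=\bigcap_{|v|=1}\{x\in\mathbb{R}^n:\langle x,v\rangle<f(v)\}$ is nonempty (for instance, $f(v)>0$ for all $v\neq 0$), and let $g\ge 0$ be a potential with $g\in L^\infty_{loc}(\mathbb{R}^n)$. For a set of finite perimeter $E\subset\mathbb{R}^n$ with reduced boundary $\partial^*E$ and measure-theoretic outer unit normal $\nu_E$, put $$\mathcal F(E)=\int_{\partial^*E} f(\nu_E)\,d|D\mathbf 1_E|,\qquad \mathcal G(E)=\int_E g\,dx\in[0,\infty],\qquad \mathcal E(E)=\mathcal F(E)+\mathcal G(E),$$ where $|D\mathbf 1_E|$ is the perimeter measure of $E$ (which equals $\mathcal H^{n-1}$ restricted to $\partial^*E$). Let $m>0$, and let $E_m$ be a minimizer of $\mathcal E$ among all sets of finite perimeter of Lebesgue measure $m$. Suppose that $E_m$ is unique up to null sets: every other such minimizer differs from $E_m$ by a set of measure zero. Let $R>0$. Then for every $\epsilon>0$ there is $w_m(\epsilon)>0$ (depending on $n,f,g,m,R,\epsilon$) such that every set of finite perimeter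 $E\subset B_R$ (the ball of radius $R$ centred at the origin) with $|E|=m$ and $$\mathcal A(E,E_m):=\Big|\mathcal F(E)-\mathcal F(E_m)+\int_E g\,dx-\int_{E_m}g\,dx\Big|<w_m(\epsilon)$$ satisfies $$\frac{|E_m\,\Delta\,E|}{|E_m|}<\epsilon .$$ -/

import Mathlib

open MeasureTheory Filter Topology

noncomputable section

namespace Almgren

/-- The divergence of a vector field on `ℝⁿ`. -/
def divergence {n : ℕ} (φ : EuclideanSpace ℝ (Fin n) → EuclideanSpace ℝ (Fin n))
    (x : EuclideanSpace ℝ (Fin n)) : ℝ :=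
  ∑ i : Fin n, (fderiv ℝ φ x (EuclideanSpace.single i 1)) i

/-- The finite vector measure `σ μ` (with `|σ| = 1` `μ`-a.e., so that `μ` is its total variation)
is the Gauss-Green measure `-D 1_E` of `E`:
`∫_E div φ dx = ∫ ⟨φ, σ⟩ dμ` for all `φ ∈ C¹_c(ℝⁿ; ℝⁿ)`.
For given `E` the measure `μ` is unique, and `σ` is unique up to `μ`-null sets. -/
structure IsGaussGreen {n : ℕ} (E : Set (EuclideanSpace ℝ (Fin n)))
    (μ : Measure (EuclideanSpace ℝ (Fin n)))
    (σ : EuclideanSpace ℝ (Fin n) → EuclideanSpace ℝ (Fin n)) : Prop where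
  finite : IsFiniteMeasure μ
  measurable : Measurable σ
  norm_eq_one : ∀ᵐ x ∂μ, ‖σ x‖ = 1
  integral_div : ∀ φ : EuclideanSpace ℝ (Fin n) → EuclideanSpace ℝ (Fin n),
    ContDiff ℝ 1 φ → HasCompactSupport φ →
      ∫ x in E, divergence φ x = ∫ x, inner ℝ (φ x) (σ x) ∂μ

/-- `E` is a (Lebesgue measurable) set of finite perimeter: the distributional gradient of its
indicator function is a finite vector measure. -/
def HasFinitePerimeter {n : ℕ} (E : Set (EuclideanSpace ℝ (Fin n))) : Prop :=
  NullMeasurableSet E volume ∧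
    ∃ p : Measure (EuclideanSpace ℝ (Fin n)) ×
      (EuclideanSpace ℝ (Fin n) → EuclideanSpace ℝ (Fin n)), IsGaussGreen E p.1 p.2

open Classical in
/-- The perimeter measure `|D 1_E|` of a set of finite perimeter. -/
def perimeterMeasure {n : ℕ} (E : Set (EuclideanSpace ℝ (Fin n))) :
    Measure (EuclideanSpace ℝ (Fin n)) :=
  if h : HasFinitePerimeter E then h.2.choose.1 else 0

open Classical in
/-- A density of the Gauss-Green measure `-D 1_E` with respect to `|D 1_E|`. -/
def gaussGreenDensity {n : ℕ} (E : Set (EuclideanSpace ℝ (Fin n))) :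
    EuclideanSpace ℝ (Fin n) → EuclideanSpace ℝ (Fin n) :=
  if h : HasFinitePerimeter E then h.2.choose.2 else 0

/-- `-D 1_E (B_r(x)) / |D 1_E| (B_r(x))`. -/
def averagedNormal {n : ℕ} (E : Set (EuclideanSpace ℝ (Fin n)))
    (x : EuclideanSpace ℝ (Fin n)) (r : ℝ) : EuclideanSpace ℝ (Fin n) :=
  ⨍ y in Metric.closedBall x r, gaussGreenDensity E y ∂(perimeterMeasure E)

/-- De Giorgi's reduced boundary `∂* E`. -/
def reducedBoundary {n : ℕ} (E : Set (EuclideanSpace ℝ (Fin n))) :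
    Set (EuclideanSpace ℝ (Fin n)) :=
  {x | (∀ r > 0, 0 < perimeterMeasure E (Metric.closedBall x r)) ∧
    ∃ ν : EuclideanSpace ℝ (Fin n), ‖ν‖ = 1 ∧ Tendsto (averagedNormal E x) (𝓝[>] 0) (𝓝 ν)}

/-- The measure-theoretic outer unit normal `ν_E(x)`, for `x ∈ ∂* E`. -/
def outerNormal {n : ℕ} (E : Set (EuclideanSpace ℝ (Fin n)))
    (x : EuclideanSpace ℝ (Fin n)) : EuclideanSpace ℝ (Fin n) :=
  limUnder (𝓝[>] (0 : ℝ)) (averagedNormal E x)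

/-- A surface tension: a convex, positively `1`-homogeneous function `ℝⁿ → [0, ∞)`. -/
structure IsSurfaceTension {n : ℕ} (f : EuclideanSpace ℝ (Fin n) → ℝ) : Prop where
  nonneg : ∀ v, 0 ≤ f v
  convex : ConvexOn ℝ Set.univ f
  homogeneous : ∀ (t : ℝ) (v : EuclideanSpace ℝ (Fin n)), 0 < t → f (t • v) = t * f v

/-- The (open) Wulff shape `K` of `f`. -/
def wulffShape {n : ℕ} (f : EuclideanSpace ℝ (Fin n) → ℝ) : Set (EuclideanSpace ℝ (Fin n)) :=
  ⋂ v ∈ Metric.sphere (0 : EuclideanSpace ℝ (Fin n)) 1, {x | inner ℝ x v < f v}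

/-- A nonnegative potential in `L^∞_loc(ℝⁿ)`. -/
structure IsPotential {n : ℕ} (g : EuclideanSpace ℝ (Fin n) → ℝ) : Prop where
  nonneg : ∀ᵐ x, 0 ≤ g x
  locallyBounded : ∀ K : Set (EuclideanSpace ℝ (Fin n)), IsCompact K →
    MemLp g ⊤ (volume.restrict K)

/-- The surface energy `𝓕(E) = ∫_{∂* E} f(ν_E)` of a set of finite perimeter, the integral being
with respect to the perimeter measure `|D 1_E|`, that is, the surface measure on `∂* E`. -/
def surfaceEnergy {n : ℕ} (f : EuclideanSpace ℝ (Fin n) → ℝ)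
    (E : Set (EuclideanSpace ℝ (Fin n))) : ENNReal :=
  ∫⁻ x in reducedBoundary E, ENNReal.ofReal (f (outerNormal E x)) ∂(perimeterMeasure E)

/-- The potential energy `𝓖(E) = ∫_E g dx ∈ [0, ∞]`. -/
def potentialEnergy {n : ℕ} (g : EuclideanSpace ℝ (Fin n) → ℝ)
    (E : Set (EuclideanSpace ℝ (Fin n))) : ENNReal :=
  ∫⁻ x in E, ENNReal.ofReal (g x)

/-- The free energy `𝓔 = 𝓕 + 𝓖`. -/
def freeEnergy {n : ℕ} (f g : EuclideanSpace ℝ (Fin n) → ℝ)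
    (E : Set (EuclideanSpace ℝ (Fin n))) : ENNReal :=
  surfaceEnergy f E + potentialEnergy g E

/-- `E` minimizes the free energy among all sets of finite perimeter of mass `m`. -/
structure IsMinimizer {n : ℕ} (f g : EuclideanSpace ℝ (Fin n) → ℝ) (m : ℝ)
    (E : Set (EuclideanSpace ℝ (Fin n))) : Prop where
  finitePerimeter : HasFinitePerimeter E
  mass : volume E = ENNReal.ofReal m
  le : ∀ E' : Set (EuclideanSpace ℝ (Fin n)), HasFinitePerimeter E' →
    volume E' = ENNReal.ofReal m → freeEnergy f g E ≤ freeEnergy f g E'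

/-- The energy gap `𝓐(E, E') = |𝓕(E) - 𝓕(E') + ∫_E g - ∫_{E'} g|`, for sets of finite energy. -/
def energyGap {n : ℕ} (f g : EuclideanSpace ℝ (Fin n) → ℝ)
    (E E' : Set (EuclideanSpace ℝ (Fin n))) : ℝ :=
  |(surfaceEnergy f E).toReal - (surfaceEnergy f E').toReal
    + (potentialEnergy g E).toReal - (potentialEnergy g E').toReal|

end Almgren

end

/-!
Suppose that sets `E k` in the ball have mass `m` and free energies tending to the minimum. Since
`∫ σ dμ = 0` for the Gauss-Green measure of a bounded set, a point `a` of the Wulff shape gives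
`∫ f(σ) dμ = ∫ (f(σ) - ⟨a, σ⟩) dμ ≥ c μ(ℝⁿ)`, so the perimeters are bounded even where `f`
vanishes. Bounded perimeter yields compactness in measure: `|E Δ (E + y)|` is at most `‖y‖` times
the perimeter, hence the sets are uniformly approximated by unions of cubes of a fine grid. The
surface energy is lower semicontinuous: a weak limit of the laws of `(x, σ k x)` under `μ k` has
fibrewise barycentres that represent the Gauss-Green measure of the limit set, and Jensen's
inequality applies. The limit set is thus a minimizer, and some `E k` is close to it.
-/

namespace Almgren

section Partition

variable {α ι : Type*} [MeasurableSpace α] {ν : Measure α} {π : α → ι} {E : Set α} {Z : Finset ι}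

theorem exists_measure_symmDiff_preimage_le_sum_min (ν : Measure α)
    (hE : ∀ x ∈ E, π x ∈ Z) :
    ∃ Z' ⊆ Z, ν (symmDiff E (π ⁻¹' Z')) ≤
      ∑ z ∈ Z, min (ν (π ⁻¹' {z} ∩ E)) (ν (π ⁻¹' {z} \ E)) := by
  classical
  let full : ι → Prop := fun z ↦ ν (π ⁻¹' {z} \ E) ≤ ν (π ⁻¹' {z} ∩ E)
  have hsub : symmDiff E (π ⁻¹' (Z.filter full : Finset ι)) ⊆
      ⋃ z ∈ Z, if full z then π ⁻¹' {z} \ E else π ⁻¹' {z} ∩ E := by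
    rintro x (⟨hxE, hxN⟩ | ⟨hxN, hxE⟩)
    · have hx : ¬ full (π x) := fun h ↦ hxN (by simpa using ⟨hE x hxE, h⟩)
      exact Set.mem_iUnion₂.2 ⟨π x, hE x hxE, by simp [hx, hxE]⟩
    · obtain ⟨hxZ, hx⟩ : π x ∈ Z ∧ full (π x) := by simpa using hxN
      exact Set.mem_iUnion₂.2 ⟨π x, hxZ, by simp [hx, hxE]⟩
  refine ⟨Z.filter full, Finset.filter_subset _ _, (measure_mono hsub).trans
    ((measure_biUnion_finset_le _ _).trans (Finset.sum_le_sum fun z _ ↦ ?_))⟩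
  split_ifs with hz
  · rw [min_eq_right hz]
  · rw [min_eq_left (not_le.1 hz).le]

theorem sum_measure_inter_mul_measure_sdiff_le [SFinite ν]
    (hπ : ∀ z, MeasurableSet (π ⁻¹' {z})) (hE : MeasurableSet E) (Z : Finset ι) :
    ∑ z ∈ Z, ν (π ⁻¹' {z} ∩ E) * ν (π ⁻¹' {z} \ E) ≤
      (ν.prod ν) {p | π p.1 = π p.2 ∧ p.1 ∈ E ∧ p.2 ∉ E} := by
  simp_rw [← Measure.prod_prod]
  rw [← measure_biUnion_finset]
  · refine measure_mono fun p hp ↦ ?_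
    obtain ⟨z, -, ⟨hp₁, hpE⟩, hp₂, hpE'⟩ := Set.mem_iUnion₂.1 hp
    exact ⟨Eq.trans hp₁ (Eq.symm hp₂), hpE, hpE'⟩
  · intro z _ w _ hzw
    exact Set.disjoint_left.2 fun p hp hp' ↦ hzw (Eq.trans (Eq.symm hp.1.1) hp'.1.1)
  · exact fun z _ ↦ ((hπ z).inter hE).prod ((hπ z).diff hE)

theorem min_mul_add_le_two_mul_mul (a b : ENNReal) : min a b * (a + b) ≤ 2 * (a * b) := by
  wlog h : a ≤ b generalizing a b
  · simpa only [min_comm, add_comm, mul_comm] using this b a (le_of_not_ge h)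
  rw [min_eq_left h, two_mul, mul_add]
  gcongr

/-- The counterpart of Poincaré's inequality for the indicator function of `E` on each cell. -/
theorem exists_measure_symmDiff_preimage_mul_le [SFinite ν]
    (hπ : ∀ z, MeasurableSet (π ⁻¹' {z})) (hE : MeasurableSet E) {q : ENNReal}
    (hq : ∀ z, ν (π ⁻¹' {z}) = q) (hEZ : ∀ x ∈ E, π x ∈ Z) :
    ∃ Z' ⊆ Z, ν (symmDiff E (π ⁻¹' Z')) * q ≤
      2 * (ν.prod ν) {p | π p.1 = π p.2 ∧ p.1 ∈ E ∧ p.2 ∉ E} := by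
  obtain ⟨Z', hZ', hle⟩ := exists_measure_symmDiff_preimage_le_sum_min ν hEZ
  refine ⟨Z', hZ', ?_⟩
  calc ν (symmDiff E (π ⁻¹' Z')) * q
      ≤ (∑ z ∈ Z, min (ν (π ⁻¹' {z} ∩ E)) (ν (π ⁻¹' {z} \ E))) * q := by gcongr
    _ = ∑ z ∈ Z, min (ν (π ⁻¹' {z} ∩ E)) (ν (π ⁻¹' {z} \ E)) *
          (ν (π ⁻¹' {z} ∩ E) + ν (π ⁻¹' {z} \ E)) := by
        simp only [Finset.sum_mul, measure_inter_add_sdiff _ hE, hq]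
    _ ≤ ∑ z ∈ Z, 2 * (ν (π ⁻¹' {z} ∩ E) * ν (π ⁻¹' {z} \ E)) :=
        Finset.sum_le_sum fun z _ ↦ min_mul_add_le_two_mul_mul _ _
    _ ≤ 2 * (ν.prod ν) {p | π p.1 = π p.2 ∧ p.1 ∈ E ∧ p.2 ∉ E} := by
        rw [← Finset.mul_sum]
        gcongr
        exact sum_measure_inter_mul_measure_sdiff_le hπ hE Z

end Partition

section SymmDiff

variable {α ι : Type*} [MeasurableSpace α] {ν : Measure α} {l : Filter ι}
  {E : ι → Set α} {S : Set α}

theorem abs_indicator_sub_indicator_superlevel_le {α : Type*} (A : Set α) (u : α → ℝ) (x : α) :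
    |A.indicator (fun _ ↦ 1) x - {y | 1 / 2 < u y}.indicator (fun _ ↦ 1) x| ≤
      2 * |A.indicator (fun _ ↦ 1) x - u x| := by
  classical
  simp only [Set.indicator_apply, Set.mem_ofPred_eq]
  split_ifs <;> grind

theorem dist_indicatorConstLp_superlevel_le [IsFiniteMeasure ν] {A : Set α}
    (hA : MeasurableSet A) (u : Lp ℝ 1 ν) (hS : MeasurableSet {x | 1 / 2 < u x}) :
    dist (indicatorConstLp 1 hA (measure_ne_top ν A) (1 : ℝ))
        (indicatorConstLp 1 hS (measure_ne_top ν _) 1) ≤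
      2 * dist (indicatorConstLp 1 hA (measure_ne_top ν A) (1 : ℝ)) u := by
  have coeFn {B : Set α} (hB : MeasurableSet B) :
      indicatorConstLp 1 hB (measure_ne_top ν B) (1 : ℝ) =ᵐ[ν] B.indicator fun _ ↦ 1 :=
    indicatorConstLp_coeFn
  rw [dist_eq_norm, dist_eq_norm]
  refine Lp.norm_le_mul_norm_of_ae_le_mul ?_
  filter_upwards [Lp.coeFn_sub (indicatorConstLp 1 hA (measure_ne_top ν A) (1 : ℝ)) u,
    Lp.coeFn_sub (indicatorConstLp 1 hA (measure_ne_top ν A) (1 : ℝ))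
      (indicatorConstLp 1 hS (measure_ne_top ν _) 1), coeFn hA, coeFn hS]
    with x hsub hsub' hxA hxS
  rw [hsub, hsub', Pi.sub_apply, Pi.sub_apply, hxA, hxS]
  exact abs_indicator_sub_indicator_superlevel_le A u x

theorem exists_tendsto_measure_symmDiff_of_forall_eventually_le [IsFiniteMeasure ν] [l.NeBot]
    (hE : ∀ k, MeasurableSet (E k))
    (h : ∀ ε : ℝ, 0 < ε → ∃ N, MeasurableSet N ∧ ∀ᶠ k in l, ν.real (symmDiff (E k) N) ≤ ε) :
    ∃ S, MeasurableSet S ∧ Tendsto (fun k ↦ ν (symmDiff (E k) S)) l (𝓝 0) := by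
  let χ : ∀ {A : Set α}, MeasurableSet A → Lp ℝ 1 ν :=
    fun hA ↦ indicatorConstLp 1 hA (measure_ne_top ν _) (1 : ℝ)
  have dist_χ : ∀ {A B : Set α} (hA : MeasurableSet A) (hB : MeasurableSet B),
      dist (χ hA) (χ hB) = ν.real (symmDiff A B) := fun hA hB ↦ by
    simp [χ, dist_indicatorConstLp_eq_norm, norm_indicatorConstLp]
  have hcauchy : Cauchy (l.map fun k ↦ χ (hE k)) := by
    refine Metric.cauchy_iff.2 ⟨inferInstance, fun ε hε ↦ ?_⟩
    obtain ⟨N, hN, hNE⟩ := h (ε / 3) (by positivity)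
    refine ⟨Metric.closedBall (χ hN) (ε / 3), ?_, fun u hu w hw ↦ ?_⟩
    · refine mem_map.2 (hNE.mono fun k hk ↦ ?_)
      rwa [← dist_χ (hE k) hN] at hk
    · linarith [dist_triangle_right u w (χ hN), Metric.mem_closedBall.1 hu,
        Metric.mem_closedBall.1 hw]
  obtain ⟨u, hu⟩ := CompleteSpace.complete hcauchy
  have hS : MeasurableSet {x | 1 / 2 < u x} :=
    measurableSet_lt measurable_const (Lp.stronglyMeasurable u).measurable
  refine ⟨_, hS, ?_⟩
  have hreal : Tendsto (fun k ↦ ν.real (symmDiff (E k) {x | 1 / 2 < u x})) l (𝓝 0) := by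
    have hdist := (tendsto_iff_dist_tendsto_zero.1 hu).const_mul 2
    rw [mul_zero] at hdist
    exact squeeze_zero (fun _ ↦ measureReal_nonneg)
      (fun k ↦ (dist_χ (hE k) hS).ge.trans (dist_indicatorConstLp_superlevel_le (hE k) u hS)) hdist
  simpa [measureReal_def, ENNReal.ofReal_toReal] using ENNReal.tendsto_ofReal hreal

theorem setLIntegral_le_add_symmDiff (f : α → ENNReal) (A B : Set α) :
    ∫⁻ x in A, f x ∂ν ≤ ∫⁻ x in B, f x ∂ν + ∫⁻ x in symmDiff A B, f x ∂ν :=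
  (lintegral_mono_set fun x hx ↦ by by_cases x ∈ B <;> simp_all [Set.mem_symmDiff]).trans
    (lintegral_union_le f B (symmDiff A B))

theorem tendsto_setLIntegral_of_tendsto_measure_symmDiff {f : α → ENNReal} {B : Set α}
    (hf : ∫⁻ x in B, f x ∂ν ≠ ⊤) (hE : ∀ k, E k ⊆ B) (hS : S ⊆ B)
    (h : Tendsto (fun k ↦ ν (symmDiff (E k) S)) l (𝓝 0)) :
    Tendsto (fun k ↦ ∫⁻ x in E k, f x ∂ν) l (𝓝 (∫⁻ x in S, f x ∂ν)) := by
  have hB : ∀ k, symmDiff (E k) S ⊆ B := fun k ↦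
    Set.symmDiff_subset_union.trans (Set.union_subset (hE k) hS)
  have hsymm : Tendsto (fun k ↦ ∫⁻ x in symmDiff (E k) S, f x ∂ν) l (𝓝 0) := by
    have hzero := tendsto_setLIntegral_zero hf (s := fun k ↦ symmDiff (E k) S)
      (tendsto_of_tendsto_of_tendsto_of_le_of_le tendsto_const_nhds h (fun _ ↦ zero_le)
        fun k ↦ Measure.restrict_le_self _)
    simpa only [Measure.restrict_restrict_of_subset (hB _)] using hzero
  have hSfin : ∫⁻ x in S, f x ∂ν ≠ ⊤ := ((lintegral_mono_set hS).trans_lt hf.lt_top).ne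
  have hlower := ENNReal.Tendsto.sub (tendsto_const_nhds (x := ∫⁻ x in S, f x ∂ν)) hsymm
    (.inl hSfin)
  have hupper := (tendsto_const_nhds (x := ∫⁻ x in S, f x ∂ν)).add hsymm
  rw [tsub_zero] at hlower
  rw [add_zero] at hupper
  refine tendsto_of_tendsto_of_tendsto_of_le_of_le hlower hupper (fun k ↦ ?_) fun k ↦
    setLIntegral_le_add_symmDiff f (E k) S
  rw [tsub_le_iff_right, symmDiff_comm]
  exact setLIntegral_le_add_symmDiff f S (E k)

theorem tendsto_setIntegral_of_tendsto_measure_symmDiff {V : Type*} [NormedAddCommGroup V]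
    [NormedSpace ℝ V] {F : α → V} (hF : Integrable F ν) (hE : ∀ k, NullMeasurableSet (E k) ν)
    (hS : NullMeasurableSet S ν) (h : Tendsto (fun k ↦ ν (symmDiff (E k) S)) l (𝓝 0)) :
    Tendsto (fun k ↦ ∫ x in E k, F x ∂ν) l (𝓝 (∫ x in S, F x ∂ν)) := by
  have hzero : ∀ s : ι → Set α, (∀ k, s k ⊆ symmDiff (E k) S) →
      Tendsto (fun k ↦ ∫ x in s k, F x ∂ν) l (𝓝 0) := fun s hs ↦
    hF.tendsto_setIntegral_nhds_zero (tendsto_of_tendsto_of_tendsto_of_le_of_le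
      tendsto_const_nhds h (fun _ ↦ zero_le) fun k ↦ measure_mono (hs k))
  have hsplit : ∀ k, ∫ x in E k, F x ∂ν =
      ∫ x in S, F x ∂ν - ∫ x in S \ E k, F x ∂ν + ∫ x in E k \ S, F x ∂ν := fun k ↦ by
    rw [← integral_inter_add_sdiff₀ hS hF.integrableOn (s := E k),
      ← integral_inter_add_sdiff₀ (hE k) hF.integrableOn (s := S), Set.inter_comm S]
    abel
  simp_rw [hsplit]
  simpa using ((tendsto_const_nhds (x := ∫ x in S, F x ∂ν)).sub
    (hzero (fun k ↦ S \ E k) fun k ↦ le_sup_right)).add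
      (hzero (fun k ↦ E k \ S) fun k ↦ le_sup_left)

end SymmDiff

section SmoothApproximation

variable {V : Type*} [NormedAddCommGroup V] [NormedSpace ℝ V] [FiniteDimensional ℝ V]

theorem exists_contDiff_one_on_compact_zero_off_open {K U : Set V} (hK : IsCompact K)
    (hU : IsOpen U) (hKU : K ⊆ U) :
    ∃ η : V → ℝ, ContDiff ℝ 1 η ∧ HasCompactSupport η ∧ Set.EqOn η 1 K ∧ Set.EqOn η 0 Uᶜ ∧
      ∀ x, η x ∈ Set.Icc 0 1 := by
  obtain ⟨W, hW, hKW, hWU, hWc⟩ := exists_open_between_and_isCompact_closure hK hU hKU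
  obtain ⟨η, hzero, hone, hη⟩ := exists_contMDiffMap_zero_one_of_isClosed
    (n := 1) (modelWithCornersSelf ℝ V) hW.isClosed_compl hK.isClosed
    (Set.disjoint_compl_left_iff_subset.2 hKW)
  have hsupp : ∀ x ∉ closure W, η x = 0 := fun x hx ↦ hzero fun hxW ↦ hx (subset_closure hxW)
  exact ⟨η, η.contMDiff.contDiff, .intro hWc hsupp, hone,
    fun x hx ↦ hsupp x fun hxW ↦ hx (hWU hxW), hη⟩

variable [MeasurableSpace V] [BorelSpace V] {ν : Measure V} [IsFiniteMeasureOnCompacts ν]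

theorem exists_contDiff_integral_abs_sub_indicator_le {A : Set V} (hA : MeasurableSet A)
    (hAν : ν A ≠ ⊤) {ε : ℝ} (hε : 0 < ε) :
    ∃ η : V → ℝ, ContDiff ℝ 1 η ∧ HasCompactSupport η ∧ (∀ x, η x ∈ Set.Icc 0 1) ∧
      ∫ x, |η x - A.indicator 1 x| ∂ν ≤ ε := by
  have hε' : ENNReal.ofReal (ε / 2) ≠ 0 := (ENNReal.ofReal_pos.2 (half_pos hε)).ne'
  obtain ⟨K, hKA, hK, hAK⟩ := hA.exists_isCompact_sdiff_lt hAν hε'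
  have hKν : ν K ≠ ⊤ := hK.measure_lt_top.ne
  obtain ⟨U, hKU, hU, -, hUK⟩ := hK.measurableSet.exists_isOpen_sdiff_lt hKν hε'
  obtain ⟨η, hη, hηc, hone, hzero, hη01⟩ := exists_contDiff_one_on_compact_zero_off_open hK hU hKU
  refine ⟨η, hη, hηc, hη01, ?_⟩
  have hmeas : MeasurableSet (A \ K ∪ U \ K) :=
    (hA.diff hK.measurableSet).union (hU.measurableSet.diff hK.measurableSet)
  have hle : ν (A \ K ∪ U \ K) ≤ ENNReal.ofReal ε := by
    rw [← add_halves ε, ENNReal.ofReal_add (half_pos hε).le (half_pos hε).le]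
    exact (measure_union_le _ _).trans (add_le_add hAK.le hUK.le)
  calc ∫ x, |η x - A.indicator 1 x| ∂ν
      ≤ ∫ x, (A \ K ∪ U \ K).indicator 1 x ∂ν := by
        refine integral_mono_of_nonneg (.of_forall fun x ↦ abs_nonneg _)
          ((integrable_indicator_iff hmeas).2
            (integrableOn_const (hle.trans_lt ENNReal.ofReal_lt_top).ne)) (.of_forall fun x ↦ ?_)
        by_cases hxK : x ∈ K
        · simp [hxK, hKA hxK, hone hxK]
        by_cases hxA : x ∈ A
        · simpa [hxK, hxA] using abs_le.2 ⟨by linarith [(hη01 x).1], by linarith [(hη01 x).2]⟩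
        · by_cases hxU : x ∈ U
          · simp [hxK, hxA, hxU, abs_of_nonneg (hη01 x).1, (hη01 x).2]
          · simp [hxA, hxU, hzero hxU]
    _ = ν.real (A \ K ∪ U \ K) := integral_indicator_one hmeas
    _ ≤ ε := ENNReal.toReal_le_of_le_ofReal hε.le hle

end SmoothApproximation

section GaussGreen

variable {n : ℕ} {E E' : Set (EuclideanSpace ℝ (Fin n))} {μ : Measure (EuclideanSpace ℝ (Fin n))}
  {σ : EuclideanSpace ℝ (Fin n) → EuclideanSpace ℝ (Fin n)} {η : EuclideanSpace ℝ (Fin n) → ℝ}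

theorem divergence_smul_const (hη : Differentiable ℝ η) (a x : EuclideanSpace ℝ (Fin n)) :
    divergence (fun y ↦ η y • a) x = fderiv ℝ η x a := by
  have hterm : ∀ i, (fderiv ℝ (fun y ↦ η y • a) x (EuclideanSpace.single i 1)) i =
      a i * fderiv ℝ η x (EuclideanSpace.single i 1) := fun i ↦ by
    rw [fderiv_smul_const (hη x)]
    simp [mul_comm]
  conv_rhs => rw [← (EuclideanSpace.basisFun (Fin n) ℝ).sum_repr a]
  simp [divergence, hterm]

namespace IsGaussGreen

theorem integrable (h : IsGaussGreen E μ σ) : Integrable σ μ :=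
  have := h.finite
  .of_bound h.measurable.aestronglyMeasurable 1 (h.norm_eq_one.mono fun _ hx ↦ hx.le)

theorem congr_ae (h : IsGaussGreen E μ σ) (hE : E =ᵐ[volume] E') : IsGaussGreen E' μ σ :=
  ⟨h.finite, h.measurable, h.norm_eq_one, fun φ hφ hφc ↦ by
    rw [← h.integral_div φ hφ hφc, setIntegral_congr_set hE]⟩

theorem setIntegral_fderiv_apply (h : IsGaussGreen E μ σ) (hη : ContDiff ℝ 1 η)
    (hηc : HasCompactSupport η) (a : EuclideanSpace ℝ (Fin n)) :
    ∫ x in E, fderiv ℝ η x a = ∫ x, η x * inner ℝ a (σ x) ∂μ := by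
  have := h.integral_div (fun y ↦ η y • a) (hη.smul contDiff_const) hηc.smul_right
  simpa only [divergence_smul_const (hη.differentiable one_ne_zero), real_inner_smul_left]
    using this

theorem setIntegral_fderiv (h : IsGaussGreen E μ σ) (hη : ContDiff ℝ 1 η)
    (hηc : HasCompactSupport η) :
    ∫ x in E, fderiv ℝ η x = innerSL ℝ (∫ x, η x • σ x ∂μ) := by
  have := h.finite
  have hD : Integrable (fderiv ℝ η) (volume.restrict E) :=
    ((hη.continuous_fderiv one_ne_zero).integrable_of_hasCompactSupport (hηc.fderiv ℝ)).integrableOn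
  obtain ⟨M, hM⟩ := hη.continuous.bounded_above_of_compact_support hηc
  have hσ : Integrable (fun x ↦ η x • σ x) μ :=
    h.integrable.bdd_smul M hη.continuous.aestronglyMeasurable (.of_forall hM)
  ext a
  rw [ContinuousLinearMap.integral_apply hD, h.setIntegral_fderiv_apply hη hηc, innerSL_apply_apply,
    real_inner_comm, ← integral_inner hσ]
  simp only [real_inner_smul_right]

theorem norm_setIntegral_fderiv_le (h : IsGaussGreen E μ σ) (hη : ContDiff ℝ 1 η)
    (hηc : HasCompactSupport η) (hη1 : ∀ x, |η x| ≤ 1) :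
    ‖∫ x in E, fderiv ℝ η x‖ ≤ μ.real Set.univ := by
  have := h.finite
  rw [h.setIntegral_fderiv hη hηc, innerSL_apply_norm, ← one_mul (μ.real Set.univ)]
  refine norm_integral_le_of_norm_le_const (h.norm_eq_one.mono fun x hx ↦ ?_)
  simpa [norm_smul, hx] using hη1 x

end IsGaussGreen

namespace HasFinitePerimeter

theorem isGaussGreen (h : HasFinitePerimeter E) :
    IsGaussGreen E (perimeterMeasure E) (gaussGreenDensity E) := by
  simpa only [perimeterMeasure, gaussGreenDensity, dif_pos h] using h.2.choose_spec

theorem ae_reducedBoundary (h : HasFinitePerimeter E) :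
    ∀ᵐ x ∂(perimeterMeasure E), x ∈ reducedBoundary E ∧
      outerNormal E x = gaussGreenDensity E x := by
  have := h.isGaussGreen.finite
  filter_upwards [(Besicovitch.vitaliFamily (perimeterMeasure E)).ae_tendsto_average
    h.isGaussGreen.integrable.locallyIntegrable, h.isGaussGreen.norm_eq_one,
    Measure.support_mem_ae (μ := perimeterMeasure E)] with x hx hnorm hsupp
  have hlim : Tendsto (averagedNormal E x) (𝓝[>] 0) (𝓝 (gaussGreenDensity E x)) :=
    hx.comp (Besicovitch.tendsto_filterAt (perimeterMeasure E) x)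
  exact ⟨⟨fun r hr ↦ (Measure.mem_support_iff_forall x).1 hsupp _ (Metric.closedBall_mem_nhds x hr),
    _, hnorm, hlim⟩, hlim.limUnder_eq⟩

theorem surfaceEnergy_eq (h : HasFinitePerimeter E) (f : EuclideanSpace ℝ (Fin n) → ℝ) :
    surfaceEnergy f E =
      ∫⁻ x, ENNReal.ofReal (f (gaussGreenDensity E x)) ∂(perimeterMeasure E) := by
  rw [surfaceEnergy, Measure.restrict_eq_self_of_ae_mem (h.ae_reducedBoundary.mono fun x hx ↦ hx.1)]
  exact lintegral_congr_ae (h.ae_reducedBoundary.mono fun x hx ↦ by simp only [hx.2])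

end HasFinitePerimeter

end GaussGreen

namespace IsSurfaceTension

variable {n : ℕ} {f : EuclideanSpace ℝ (Fin n) → ℝ}

theorem continuous (hf : IsSurfaceTension f) : Continuous f :=
  hf.convex.locallyLipschitz.continuous

theorem map_zero (hf : IsSurfaceTension f) : f 0 = 0 := by
  have := hf.homogeneous 2 0 two_pos
  rw [smul_zero] at this
  linarith

theorem exists_le_of_norm_le_one (hf : IsSurfaceTension f) : ∃ L, ∀ v, ‖v‖ ≤ 1 → f v ≤ L := by
  obtain ⟨L, hL⟩ := (isCompact_closedBall (0 : EuclideanSpace ℝ (Fin n)) 1).bddAbove_image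
    hf.continuous.continuousOn
  exact ⟨L, fun v hv ↦ hL ⟨v, by simpa using hv, rfl⟩⟩

/-- The linear term is harmless: the Gauss-Green measure of a bounded set has total mass zero. -/
theorem exists_add_inner_le (hf : IsSurfaceTension f) (hK : (wulffShape f).Nonempty) :
    ∃ (a : EuclideanSpace ℝ (Fin n)) (c : ℝ), 0 < c ∧ ∀ v, ‖v‖ = 1 → c + inner ℝ a v ≤ f v := by
  obtain ⟨a, ha⟩ := hK
  have hpos : ∀ v ∈ Metric.sphere (0 : EuclideanSpace ℝ (Fin n)) 1, 0 < f v - inner ℝ a v :=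
    fun v hv ↦ sub_pos.2 (Set.mem_iInter₂.1 ha v hv)
  obtain ⟨c, hc, hle⟩ := (isCompact_sphere (0 : EuclideanSpace ℝ (Fin n)) 1).exists_forall_le'
    (hf.continuous.sub (continuous_const.inner continuous_id)).continuousOn hpos
  exact ⟨a, c, hc, fun v hv ↦ le_sub_iff_add_le.1 (hle v (by simpa using hv))⟩

end IsSurfaceTension

section Translation

theorem hasFDerivAt_integral_comp_sub {V : Type*} [NormedAddCommGroup V] [NormedSpace ℝ V]
    [MeasurableSpace V] [BorelSpace V] [SecondCountableTopology V] {ν : Measure V}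
    [IsFiniteMeasure ν] {η : V → ℝ} (hη : ContDiff ℝ 1 η) (hηc : HasCompactSupport η) (v : V) :
    HasFDerivAt (fun v ↦ ∫ x, η (x - v) ∂ν) (∫ x, -fderiv ℝ η (x - v) ∂ν) v := by
  have hD : Continuous (fderiv ℝ η) := hη.continuous_fderiv one_ne_zero
  obtain ⟨M, hM⟩ := hη.continuous.bounded_above_of_compact_support hηc
  obtain ⟨M', hM'⟩ := hD.bounded_above_of_compact_support (hηc.fderiv ℝ)
  refine hasFDerivAt_integral_of_dominated_of_fderiv_le (F := fun v x ↦ η (x - v))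
    (F' := fun v x ↦ -fderiv ℝ η (x - v)) (bound := fun _ ↦ M') univ_mem
    (.of_forall fun w ↦ (hη.continuous.comp (by fun_prop)).aestronglyMeasurable)
    (.of_bound (hη.continuous.comp (by fun_prop)).aestronglyMeasurable M (.of_forall fun x ↦ hM _))
    (hD.comp (by fun_prop)).neg.aestronglyMeasurable
    (.of_forall fun x w _ ↦ (norm_neg _).trans_le (hM' _)) (integrable_const _)
    (.of_forall fun x w _ ↦ ?_)
  have hsub : HasFDerivAt (fun w ↦ x - w) (-ContinuousLinearMap.id ℝ V) w :=
    (hasFDerivAt_id w).const_sub x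
  simpa [Function.comp_def] using
    ((hη.differentiable one_ne_zero) (x - w)).hasFDerivAt.comp w hsub

variable {n : ℕ} {E : Set (EuclideanSpace ℝ (Fin n))} {μ : Measure (EuclideanSpace ℝ (Fin n))}
  {σ : EuclideanSpace ℝ (Fin n) → EuclideanSpace ℝ (Fin n)} {η : EuclideanSpace ℝ (Fin n) → ℝ}

namespace IsGaussGreen

theorem abs_setIntegral_comp_sub_sub_le (h : IsGaussGreen E μ σ) (hE : volume E ≠ ⊤)
    (hη : ContDiff ℝ 1 η) (hηc : HasCompactSupport η) (hη1 : ∀ x, |η x| ≤ 1)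
    (v : EuclideanSpace ℝ (Fin n)) :
    |(∫ x in E, η (x - v)) - ∫ x in E, η x| ≤ μ.real Set.univ * ‖v‖ := by
  have : IsFiniteMeasure (volume.restrict E) := isFiniteMeasure_restrict.2 hE
  have hbound : ∀ w, ‖∫ x in E, -fderiv ℝ η (x - w)‖ ≤ μ.real Set.univ := fun w ↦ by
    rw [integral_neg, norm_neg]
    simpa only [fderiv_comp_sub] using
      h.norm_setIntegral_fderiv_le (η := fun x ↦ η (x - w))
        (hη.comp (contDiff_id.sub contDiff_const)) (hηc.comp_homeomorph (Homeomorph.subRight w))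
        fun x ↦ hη1 _
  simpa using convex_univ.norm_image_sub_le_of_norm_hasFDerivWithin_le
    (fun w _ ↦ (hasFDerivAt_integral_comp_sub (ν := volume.restrict E) hη hηc w).hasFDerivWithinAt)
    (fun w _ ↦ hbound w) (Set.mem_univ 0) (Set.mem_univ v)

theorem volume_inter_translate_compl_le (h : IsGaussGreen E μ σ) (hEm : MeasurableSet E)
    (hE : volume E ≠ ⊤) (v : EuclideanSpace ℝ (Fin n)) :
    volume {x | x ∈ E ∧ x + v ∉ E} ≤ ENNReal.ofReal (μ.real Set.univ * ‖v‖) := by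
  set A := {x | x ∈ E ∧ x + v ∉ E}
  have hA : MeasurableSet A := hEm.inter (measurable_add_const v hEm.compl)
  have hAfin : volume A ≠ ⊤ := ((measure_mono fun x hx ↦ hx.1).trans_lt hE.lt_top).ne
  rw [← ENNReal.ofReal_toReal hAfin]
  refine ENNReal.ofReal_le_ofReal (le_of_forall_pos_le_add fun ε hε ↦ ?_)
  obtain ⟨η, hη, hηc, hη01, happrox⟩ := exists_contDiff_integral_abs_sub_indicator_le hA hAfin
    (half_pos hε)
  have hηi : Integrable η := hη.continuous.integrable_of_hasCompactSupport hηc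
  have hAi : Integrable (A.indicator (1 : EuclideanSpace ℝ (Fin n) → ℝ)) :=
    (integrable_indicator_iff hA).2 (integrableOn_const hAfin)
  have hclose : ∀ w, |(∫ x in E, η (x - w)) - ∫ x in E, A.indicator 1 (x - w)| ≤ ε / 2 := fun w ↦ by
    rw [← integral_sub (hηi.comp_sub_right w).integrableOn (hAi.comp_sub_right w).integrableOn]
    calc |∫ x in E, (η (x - w) - A.indicator 1 (x - w))|
        ≤ ∫ x in E, |η (x - w) - A.indicator 1 (x - w)| := abs_integral_le_integral_abs
      _ ≤ ∫ x, |η (x - w) - A.indicator 1 (x - w)| :=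
          setIntegral_le_integral ((hηi.sub hAi).abs.comp_sub_right w)
            (.of_forall fun x ↦ abs_nonneg _)
      _ = ∫ x, |η x - A.indicator 1 x| :=
          integral_sub_right_eq_self (fun x ↦ |η x - A.indicator 1 x|) w
      _ ≤ ε / 2 := happrox
  have hself : ∫ x in E, A.indicator 1 (x - 0) = volume.real A := by
    simp only [sub_zero]
    rw [integral_indicator_one hA, measureReal_restrict_apply hA,
      Set.inter_eq_left.2 fun x hx ↦ hx.1]
  have htranslate : ∫ x in E, A.indicator (1 : EuclideanSpace ℝ (Fin n) → ℝ) (x - v) = 0 :=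
    setIntegral_eq_zero_of_forall_eq_zero fun x hx ↦
      Set.indicator_of_notMem (fun hxA ↦ hxA.2 (by simpa using hx)) _
  have hzero := hclose 0
  have hv := hclose v
  rw [hself] at hzero
  rw [htranslate, sub_zero] at hv
  have hlip := h.abs_setIntegral_comp_sub_sub_le hE hη hηc
    (fun x ↦ abs_le.2 ⟨by linarith [(hη01 x).1], (hη01 x).2⟩) v
  simp only [sub_zero] at hzero
  change volume.real A ≤ _
  linarith [(abs_le.1 hzero).1, (abs_le.1 hv).2, (abs_le.1 hlip).1]

/-- The change of variables `(x, y) ↦ (x, y - x)` reduces this to the translation estimate. -/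
theorem volume_prod_dist_le_le (h : IsGaussGreen E μ σ) (hEm : MeasurableSet E)
    (hE : volume E ≠ ⊤) (r : ℝ) :
    (volume.prod volume) {p : EuclideanSpace ℝ (Fin n) × EuclideanSpace ℝ (Fin n) |
        dist p.1 p.2 ≤ r ∧ p.1 ∈ E ∧ p.2 ∉ E} ≤
      ENNReal.ofReal (μ.real Set.univ * r) *
        volume (Metric.closedBall (0 : EuclideanSpace ℝ (Fin n)) r) := by
  set T := {p : EuclideanSpace ℝ (Fin n) × EuclideanSpace ℝ (Fin n) |
    dist p.1 p.2 ≤ r ∧ p.1 ∈ E ∧ p.2 ∉ E}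
  have hT : MeasurableSet T := by
    have hdist : IsClosed {p : EuclideanSpace ℝ (Fin n) × EuclideanSpace ℝ (Fin n) |
      dist p.1 p.2 ≤ r} := isClosed_le (by fun_prop) continuous_const
    exact hdist.measurableSet.inter ((measurable_fst hEm).inter (measurable_snd hEm.compl))
  have hshear := measurePreserving_prod_add (volume : Measure (EuclideanSpace ℝ (Fin n)))
    (volume : Measure (EuclideanSpace ℝ (Fin n)))
  rw [← hshear.measure_preimage hT.nullMeasurableSet,
    Measure.prod_apply_symm (hshear.measurable hT),
    ← lintegral_indicator_const Metric.isClosed_closedBall.measurableSet]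
  refine lintegral_mono fun v ↦ ?_
  by_cases hv : ‖v‖ ≤ r
  · rw [Set.indicator_of_mem (by simpa using hv)]
    refine (measure_mono fun x hx ↦ ?_).trans ((h.volume_inter_translate_compl_le hEm hE v).trans
      (ENNReal.ofReal_le_ofReal (by gcongr)))
    exact hx.2
  · have hempty : (fun x ↦ (x, v)) ⁻¹' ((fun z ↦ (z.1, z.1 + z.2)) ⁻¹' T) = ∅ :=
      Set.eq_empty_of_forall_notMem fun x hx ↦ hv (by simpa [dist_eq_norm] using hx.1)
    rw [hempty, measure_empty]
    exact zero_le

end IsGaussGreen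
end Translation

section Grid

open BoxIntegral

/-- The label of the cube of side `1 / N` containing `x`, for the partition of `ℝⁿ` into the
half-open cubes with corners in `N⁻¹ ℤⁿ`. -/
noncomputable def gridIndex {n : ℕ} (N : ℕ) (x : EuclideanSpace ℝ (Fin n)) : Fin n → ℤ :=
  unitPartition.index N (WithLp.ofLp x)

variable {n N : ℕ} [NeZero N]

theorem gridIndex_preimage_singleton (z : Fin n → ℤ) :
    gridIndex N ⁻¹' {z} = (MeasurableEquiv.toLp 2 (Fin n → ℝ)).symm ⁻¹' unitPartition.box N z :=
  Set.ext fun _ ↦ unitPartition.mem_box_iff_index.symm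

theorem measurableSet_gridIndex_preimage_singleton (z : Fin n → ℤ) :
    MeasurableSet (gridIndex N ⁻¹' {z}) := by
  rw [gridIndex_preimage_singleton]
  exact (MeasurableEquiv.toLp 2 (Fin n → ℝ)).symm.measurable (Box.measurableSet_coe _)

theorem measurableSet_gridIndex_preimage (Z : Finset (Fin n → ℤ)) :
    MeasurableSet (gridIndex N ⁻¹' (Z : Set (Fin n → ℤ))) := by
  rw [← Set.biUnion_preimage_singleton]
  exact Finset.measurableSet_biUnion _ fun z _ ↦ measurableSet_gridIndex_preimage_singleton z

theorem volume_gridIndex_preimage_singleton (z : Fin n → ℤ) :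
    volume (gridIndex N ⁻¹' {z}) = 1 / (N : ENNReal) ^ n := by
  rw [gridIndex_preimage_singleton,
    (EuclideanSpace.volume_preserving_symm_measurableEquiv_toLp (Fin n)).measure_preimage_equiv,
    unitPartition.volume_box, Fintype.card_fin]

theorem dist_le_of_gridIndex_eq {x y : EuclideanSpace ℝ (Fin n)}
    (h : gridIndex N x = gridIndex N y) : dist x y ≤ √n / N := by
  have hx : WithLp.ofLp x ∈ unitPartition.box N (gridIndex N y) :=
    unitPartition.mem_box_iff_index.2 h
  have hy : WithLp.ofLp y ∈ unitPartition.box N (gridIndex N y) :=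
    unitPartition.mem_box_iff_index.2 rfl
  have hsup : dist (WithLp.ofLp x) (WithLp.ofLp y) ≤ 1 / N :=
    (Metric.dist_le_diam_of_mem (Box.isBounded_Icc _) (Box.coe_subset_Icc hx)
      (Box.coe_subset_Icc hy)).trans (unitPartition.diam_boxIcc N _)
  have hL2 := (PiLp.antilipschitzWith_ofLp 2 fun _ : Fin n ↦ ℝ).le_mul_dist x y
  calc dist x y ≤ √n * dist (WithLp.ofLp x) (WithLp.ofLp y) := by
        simpa [Real.sqrt_eq_rpow] using hL2
    _ ≤ √n * (1 / N) := by gcongr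
    _ = √n / N := by ring

theorem exists_finset_gridIndex_mem {B : Set (EuclideanSpace ℝ (Fin n))}
    (hB : Bornology.IsBounded B) (N : ℕ) [NeZero N] :
    ∃ Z : Finset (Fin n → ℤ), ∀ x ∈ B, gridIndex N x ∈ Z := by
  obtain ⟨I, hI, hBI⟩ := le_hasIntegralVertices_of_isBounded
    ((PiLp.lipschitzWith_ofLp 2 fun _ : Fin n ↦ ℝ).isBounded_image hB)
  exact ⟨unitPartition.admissibleIndex N I, fun x hx ↦
    unitPartition.mem_admissibleIndex_of_mem_box N hI (hBI ⟨x, hx, rfl⟩)⟩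

theorem volume_closedBall_div (r : ℝ) :
    volume (Metric.closedBall (0 : EuclideanSpace ℝ (Fin n)) (r / N)) =
      1 / (N : ENNReal) ^ n * volume (Metric.closedBall (0 : EuclideanSpace ℝ (Fin n)) r) := by
  have hN : (0 : ℝ) < N := Nat.cast_pos.2 (NeZero.pos N)
  rw [div_eq_inv_mul, Measure.addHaar_closedBall_mul_of_pos _ _ (inv_pos.2 hN),
    finrank_euclideanSpace_fin, inv_pow, ENNReal.ofReal_inv_of_pos (pow_pos hN n),
    ENNReal.ofReal_pow hN.le, ENNReal.ofReal_natCast, one_div]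

variable {E : Set (EuclideanSpace ℝ (Fin n))} {μ : Measure (EuclideanSpace ℝ (Fin n))}
  {σ : EuclideanSpace ℝ (Fin n) → EuclideanSpace ℝ (Fin n)}

theorem IsGaussGreen.exists_volume_symmDiff_gridIndex_preimage_le (h : IsGaussGreen E μ σ)
    (hEm : MeasurableSet E) (hE : volume E ≠ ⊤) {Z : Finset (Fin n → ℤ)}
    (hEZ : ∀ x ∈ E, gridIndex N x ∈ Z) :
    ∃ Z' ⊆ Z, volume (symmDiff E (gridIndex N ⁻¹' (Z' : Set (Fin n → ℤ)))) ≤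
      2 * (ENNReal.ofReal (μ.real Set.univ * (√n / N)) *
        volume (Metric.closedBall (0 : EuclideanSpace ℝ (Fin n)) √n)) := by
  set q : ENNReal := 1 / (N : ENNReal) ^ n
  have hq0 : q ≠ 0 := by simp [q]
  have hqtop : q ≠ ⊤ := by simp [q, NeZero.ne N]
  obtain ⟨Z', hZ', hle⟩ := exists_measure_symmDiff_preimage_mul_le
    measurableSet_gridIndex_preimage_singleton hEm volume_gridIndex_preimage_singleton hEZ
  refine ⟨Z', hZ', (ENNReal.mul_le_mul_iff_left hq0 hqtop).1 ?_⟩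
  calc volume (symmDiff E (gridIndex N ⁻¹' (Z' : Set (Fin n → ℤ)))) * q
      ≤ 2 * (volume.prod volume) {p : EuclideanSpace ℝ (Fin n) × EuclideanSpace ℝ (Fin n) |
          gridIndex N p.1 = gridIndex N p.2 ∧ p.1 ∈ E ∧ p.2 ∉ E} := hle
    _ ≤ 2 * (volume.prod volume) {p : EuclideanSpace ℝ (Fin n) × EuclideanSpace ℝ (Fin n) |
          dist p.1 p.2 ≤ √n / N ∧ p.1 ∈ E ∧ p.2 ∉ E} := by
        gcongr with p
        exact dist_le_of_gridIndex_eq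
    _ ≤ 2 * (ENNReal.ofReal (μ.real Set.univ * (√n / N)) *
          volume (Metric.closedBall (0 : EuclideanSpace ℝ (Fin n)) (√n / N))) := by
        gcongr
        exact h.volume_prod_dist_le_le hEm hE _
    _ = _ := by
        rw [volume_closedBall_div]
        ring

end Grid

section Compactness

variable {n : ℕ}

/-- Total boundedness of the sets of perimeter at most `C` in `B`: approximate by unions of cells
of a fine grid. -/
theorem exists_finite_net_of_perimeter_le {B : Set (EuclideanSpace ℝ (Fin n))}
    (hB : Bornology.IsBounded B) (C : ℝ) {ε : ENNReal} (hε : 0 < ε) :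
    ∃ 𝒩 : Set (Set (EuclideanSpace ℝ (Fin n))), 𝒩.Finite ∧ (∀ N ∈ 𝒩, MeasurableSet N) ∧
      ∀ E μ σ, IsGaussGreen E μ σ → MeasurableSet E → E ⊆ B → μ.real Set.univ ≤ C →
        ∃ N ∈ 𝒩, volume (symmDiff E N) ≤ ε := by
  set V := volume (Metric.closedBall (0 : EuclideanSpace ℝ (Fin n)) √n)
  have hVtop : V ≠ ⊤ := measure_closedBall_lt_top.ne
  have herror : Tendsto (fun k : ℕ ↦ 2 * (ENNReal.ofReal (C * (√n / k)) * V)) atTop (𝓝 0) := by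
    have hreal : Tendsto (fun k : ℕ ↦ C * (√n / k)) atTop (𝓝 0) := by
      simpa using (tendsto_const_div_atTop_nhds_zero_nat √n).const_mul C
    simpa using ENNReal.Tendsto.const_mul (a := 2)
      (ENNReal.Tendsto.mul_const (ENNReal.tendsto_ofReal hreal) (.inr hVtop)) (.inr (by simp))
  obtain ⟨N, hNε, hN⟩ :=
    ((herror.eventually (gt_mem_nhds hε)).and (eventually_ne_atTop 0)).exists
  have : NeZero N := ⟨hN⟩
  obtain ⟨Z, hZ⟩ := exists_finset_gridIndex_mem hB N
  refine ⟨(fun Z' : Finset (Fin n → ℤ) ↦ gridIndex N ⁻¹' (Z' : Set (Fin n → ℤ))) '' Z.powerset,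
    (Finset.finite_toSet _).image _, ?_, fun E μ σ h hEm hEB hμ ↦ ?_⟩
  · rintro _ ⟨Z', -, rfl⟩
    exact measurableSet_gridIndex_preimage Z'
  · obtain ⟨Z', hZ', hle⟩ := h.exists_volume_symmDiff_gridIndex_preimage_le hEm
      ((measure_mono hEB).trans_lt hB.measure_lt_top).ne fun x hx ↦ hZ x (hEB hx)
    refine ⟨_, ⟨Z', by simpa using hZ', rfl⟩, (hle.trans ?_).trans hNε.le⟩
    gcongr

theorem exists_tendsto_volume_symmDiff {ι : Type*} (𝒰 : Ultrafilter ι)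
    {B : Set (EuclideanSpace ℝ (Fin n))} (hB : Bornology.IsBounded B) (hBm : MeasurableSet B)
    {C : ℝ} {E : ι → Set (EuclideanSpace ℝ (Fin n))} {μ : ι → Measure (EuclideanSpace ℝ (Fin n))}
    {σ : ι → EuclideanSpace ℝ (Fin n) → EuclideanSpace ℝ (Fin n)}
    (hE : ∀ k, IsGaussGreen (E k) (μ k) (σ k)) (hEm : ∀ k, NullMeasurableSet (E k))
    (hEB : ∀ k, E k ⊆ B) (hC : ∀ k, (μ k).real Set.univ ≤ C) :
    ∃ S ⊆ B, MeasurableSet S ∧ Tendsto (fun k ↦ volume (symmDiff (E k) S)) 𝒰 (𝓝 0) := by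
  have : IsFiniteMeasure (volume.restrict B) :=
    isFiniteMeasure_restrict.2 hB.measure_lt_top.ne
  choose E' hE'E hE'm hE'ae using fun k ↦ (hEm k).exists_measurable_subset_ae_eq
  obtain ⟨S, hSm, hS⟩ := exists_tendsto_measure_symmDiff_of_forall_eventually_le
    (ν := volume.restrict B) (l := (𝒰 : Filter ι)) hE'm fun ε hε ↦ by
      obtain ⟨𝒩, hfin, hmeas, hnet⟩ :=
        exists_finite_net_of_perimeter_le hB C (ENNReal.ofReal_pos.2 hε)
      obtain ⟨N, hN, hev⟩ := (Ultrafilter.eventually_exists_mem_iff (f := 𝒰) hfin).1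
        (.of_forall fun k ↦ hnet (E' k) (μ k) (σ k) ((hE k).congr_ae (hE'ae k).symm) (hE'm k)
          ((hE'E k).trans (hEB k)) (hC k))
      refine ⟨N, hmeas N hN, hev.mono fun k hk ↦ ENNReal.toReal_le_of_le_ofReal hε.le ?_⟩
      exact (Measure.restrict_apply_le B _).trans hk
  refine ⟨S ∩ B, Set.inter_subset_right, hSm.inter hBm, hS.congr fun k ↦ ?_⟩
  rw [Measure.restrict_apply ((hE'm k).symmDiff hSm), Set.inter_comm,
    Set.inter_symmDiff_distrib_left, Set.inter_eq_right.2 ((hE'E k).trans (hEB k)), Set.inter_comm]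
  exact measure_congr ((hE'ae k).symmDiff (ae_eq_refl _))

end Compactness

section PolarUniqueness

open scoped ContDiff

theorem norm_toReal_rnDeriv_smul_ae_eq {α W : Type*} [MeasurableSpace α] [NormedAddCommGroup W]
    [NormedSpace ℝ W] {μ κ : Measure α} [SigmaFinite μ] [SigmaFinite κ] {σ : α → W}
    (hσ : ∀ᵐ x ∂μ, ‖σ x‖ = 1) :
    ∀ᵐ x ∂κ, ‖(μ.rnDeriv κ x).toReal • σ x‖ = (μ.rnDeriv κ x).toReal := by
  filter_upwards [Measure.ae_rnDeriv_ne_zero_imp_of_ae κ hσ] with x hx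
  obtain h0 | h0 := eq_or_ne (μ.rnDeriv κ x) 0
  · simp [h0]
  · rw [norm_smul, hx h0, mul_one, Real.norm_of_nonneg ENNReal.toReal_nonneg]

variable {V W : Type*} [NormedAddCommGroup V] [NormedSpace ℝ V] [FiniteDimensional ℝ V]
  [MeasurableSpace V] [BorelSpace V] [NormedAddCommGroup W] [NormedSpace ℝ W]
  [CompleteSpace W] {μ μ' : Measure V} [IsFiniteMeasure μ] [IsFiniteMeasure μ'] {σ σ' : V → W}

theorem toReal_rnDeriv_smul_ae_eq_of_integral_contDiff_smul_eq {κ : Measure V}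
    [SigmaFinite κ] (hμκ : μ ≪ κ) (hμ'κ : μ' ≪ κ) (hσ : Integrable σ μ) (hσ' : Integrable σ' μ')
    (h : ∀ η : V → ℝ, ContDiff ℝ ∞ η → HasCompactSupport η →
      ∫ x, η x • σ x ∂μ = ∫ x, η x • σ' x ∂μ') :
    (fun x ↦ (μ.rnDeriv κ x).toReal • σ x) =ᵐ[κ] fun x ↦ (μ'.rnDeriv κ x).toReal • σ' x := by
  refine ae_eq_of_integral_contDiff_smul_eq
    ((integrable_rnDeriv_smul_iff hμκ).2 hσ).locallyIntegrable
    ((integrable_rnDeriv_smul_iff hμ'κ).2 hσ').locallyIntegrable fun η hη hηc ↦ ?_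
  simp only [smul_comm (η _)]
  rw [integral_rnDeriv_smul hμκ, integral_rnDeriv_smul hμ'κ, h η hη hηc]

theorem measure_eq_of_integral_contDiff_smul_eq (hσi : Integrable σ μ)
    (hσi' : Integrable σ' μ') (hσ : ∀ᵐ x ∂μ, ‖σ x‖ = 1) (hσ' : ∀ᵐ x ∂μ', ‖σ' x‖ = 1)
    (h : ∀ η : V → ℝ, ContDiff ℝ ∞ η → HasCompactSupport η →
      ∫ x, η x • σ x ∂μ = ∫ x, η x • σ' x ∂μ') : μ = μ' := by
  have hμ : μ ≪ μ + μ' := (Measure.le_add_right le_rfl).absolutelyContinuous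
  have hμ' : μ' ≪ μ + μ' := (Measure.le_add_left le_rfl).absolutelyContinuous
  suffices hdensity : μ.rnDeriv (μ + μ') =ᵐ[μ + μ'] μ'.rnDeriv (μ + μ') from
    (Measure.withDensity_rnDeriv_eq _ _ hμ).symm.trans
      ((withDensity_congr_ae hdensity).trans (Measure.withDensity_rnDeriv_eq _ _ hμ'))
  filter_upwards [toReal_rnDeriv_smul_ae_eq_of_integral_contDiff_smul_eq hμ hμ' hσi hσi' h,
    norm_toReal_rnDeriv_smul_ae_eq (κ := μ + μ') hσ,
    norm_toReal_rnDeriv_smul_ae_eq (κ := μ + μ') hσ', Measure.rnDeriv_lt_top μ (μ + μ'),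
    Measure.rnDeriv_lt_top μ' (μ + μ')] with x heq hnorm hnorm' hfin hfin'
  rw [← ENNReal.toReal_eq_toReal_iff' hfin.ne hfin'.ne, ← hnorm, ← hnorm', heq]

end PolarUniqueness

section GaussGreenMeasure

variable {n : ℕ} {E : Set (EuclideanSpace ℝ (Fin n))} {μ μ' : Measure (EuclideanSpace ℝ (Fin n))}
  {σ σ' : EuclideanSpace ℝ (Fin n) → EuclideanSpace ℝ (Fin n)} {f : EuclideanSpace ℝ (Fin n) → ℝ}

namespace IsGaussGreen

theorem integral_smul_eq (h : IsGaussGreen E μ σ) (h' : IsGaussGreen E μ' σ')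
    {η : EuclideanSpace ℝ (Fin n) → ℝ} (hη : ContDiff ℝ 1 η) (hηc : HasCompactSupport η) :
    ∫ x, η x • σ x ∂μ = ∫ x, η x • σ' x ∂μ' :=
  (innerSL_inj (𝕜 := ℝ)).1 ((h.setIntegral_fderiv hη hηc).symm.trans
    (h'.setIntegral_fderiv hη hηc))

theorem measure_eq (h : IsGaussGreen E μ σ) (h' : IsGaussGreen E μ' σ') : μ = μ' :=
  have := h.finite
  have := h'.finite
  measure_eq_of_integral_contDiff_smul_eq h.integrable h'.integrable h.norm_eq_one h'.norm_eq_one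
    fun _ hη hηc ↦ h.integral_smul_eq h' (hη.of_le (mod_cast le_top)) hηc

theorem density_ae_eq (h : IsGaussGreen E μ σ) (h' : IsGaussGreen E μ σ') : σ =ᵐ[μ] σ' :=
  ae_eq_of_integral_contDiff_smul_eq h.integrable.locallyIntegrable h'.integrable.locallyIntegrable
    fun _ hη hηc ↦ h.integral_smul_eq h' (hη.of_le (mod_cast le_top)) hηc

theorem measure_compl_closure (h : IsGaussGreen E μ σ) : μ (closure E)ᶜ = 0 := by
  have hσ : ∀ᵐ x ∂μ, x ∈ (closure E)ᶜ → σ x = 0 := by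
    refine isClosed_closure.isOpen_compl.ae_eq_zero_of_integral_contDiff_smul_eq_zero
      (h.integrable.locallyIntegrable.locallyIntegrableOn _) fun η hη hηc hsupp ↦ ?_
    refine (innerSL_inj (𝕜 := ℝ)).1 ?_
    rw [← h.setIntegral_fderiv (hη.of_le (mod_cast le_top)) hηc, _root_.map_zero]
    exact setIntegral_eq_zero_of_forall_eq_zero fun x hx ↦ image_eq_zero_of_notMem_tsupport
      fun hxη ↦ hsupp (tsupport_fderiv_subset ℝ hxη) (subset_closure hx)
  refine measure_eq_zero_iff_ae_notMem.2 ?_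
  filter_upwards [hσ, h.norm_eq_one] with x hx hnorm hxE
  simp [hx hxE] at hnorm

theorem integral_eq_zero (h : IsGaussGreen E μ σ) (hE : Bornology.IsBounded E) :
    ∫ x, σ x ∂μ = 0 := by
  obtain ⟨R, hER⟩ := hE.subset_ball 0
  obtain ⟨η, hη, hηc, hη1, -⟩ := exists_contDiff_one_on_compact_zero_off_open
    (isCompact_closedBall (0 : EuclideanSpace ℝ (Fin n)) R) isOpen_univ (Set.subset_univ _)
  have hησ : ∫ x, η x • σ x ∂μ = ∫ x, σ x ∂μ := by
    refine integral_congr_ae ?_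
    filter_upwards [measure_eq_zero_iff_ae_notMem.1 h.measure_compl_closure] with x hx
    rw [hη1 (closure_minimal (hER.trans Metric.ball_subset_closedBall) Metric.isClosed_closedBall
      (not_not.1 hx)), Pi.one_apply, one_smul]
  refine (innerSL_inj (𝕜 := ℝ)).1 ?_
  rw [← hησ, ← h.setIntegral_fderiv hη hηc, _root_.map_zero]
  refine setIntegral_eq_zero_of_forall_eq_zero fun x hx ↦ ?_
  have hconst : η =ᶠ[𝓝 x] fun _ ↦ 1 := by
    filter_upwards [Metric.isOpen_ball.mem_nhds (hER hx)] with y hy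
    exact hη1 (Metric.ball_subset_closedBall hy)
  rw [hconst.fderiv_eq, fderiv_fun_const, Pi.zero_apply]

theorem integrable_comp (h : IsGaussGreen E μ σ) (hf : IsSurfaceTension f) :
    Integrable (fun x ↦ f (σ x)) μ := by
  have := h.finite
  obtain ⟨L, hL⟩ := hf.exists_le_of_norm_le_one
  refine .of_bound (hf.continuous.measurable.comp h.measurable).aestronglyMeasurable L
    (h.norm_eq_one.mono fun x hx ↦ ?_)
  rw [Real.norm_of_nonneg (hf.nonneg _)]
  exact hL _ hx.le

theorem surfaceEnergy_eq (h : IsGaussGreen E μ σ) (hEm : NullMeasurableSet E)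
    (hf : IsSurfaceTension f) : surfaceEnergy f E = ENNReal.ofReal (∫ x, f (σ x) ∂μ) := by
  have hE : HasFinitePerimeter E := ⟨hEm, (μ, σ), h⟩
  obtain rfl := h.measure_eq hE.isGaussGreen
  rw [hE.surfaceEnergy_eq, ofReal_integral_eq_lintegral_ofReal (h.integrable_comp hf)
    (.of_forall fun x ↦ hf.nonneg _)]
  exact lintegral_congr_ae
    ((hE.isGaussGreen.density_ae_eq h).mono fun x hx ↦ congrArg (fun v ↦ ENNReal.ofReal (f v)) hx)

end IsGaussGreen

theorem HasFinitePerimeter.surfaceEnergy_ne_top (h : HasFinitePerimeter E)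
    (hf : IsSurfaceTension f) : surfaceEnergy f E ≠ ⊤ := by
  rw [h.isGaussGreen.surfaceEnergy_eq h.1 hf]
  exact ENNReal.ofReal_ne_top

theorem IsSurfaceTension.exists_mul_perimeter_le (hf : IsSurfaceTension f)
    (hK : (wulffShape f).Nonempty) :
    ∃ c > 0, ∀ E μ σ, IsGaussGreen E μ σ → Bornology.IsBounded E →
      c * μ.real Set.univ ≤ ∫ x, f (σ x) ∂μ := by
  obtain ⟨a, c, hc, hle⟩ := hf.exists_add_inner_le hK
  refine ⟨c, hc, fun E μ σ h hE ↦ ?_⟩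
  have := h.finite
  calc c * μ.real Set.univ = ∫ x, (c + inner ℝ a (σ x)) ∂μ := by
        rw [integral_add (integrable_const c) (h.integrable.const_inner a), integral_const,
          integral_inner h.integrable, h.integral_eq_zero hE, inner_zero_right, add_zero,
          smul_eq_mul, mul_comm]
    _ ≤ ∫ x, f (σ x) ∂μ :=
        integral_mono_ae ((integrable_const c).add (h.integrable.const_inner a))
          (h.integrable_comp hf) (h.norm_eq_one.mono fun x hx ↦ hle _ hx)

end GaussGreenMeasure

section WeakLimit

theorem integrable_of_measure_compl_eq_zero {X F : Type*} [TopologicalSpace X]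
    [T2Space X] [MeasurableSpace X] [BorelSpace X] [NormedAddCommGroup F]
    {Λ : Measure X} [IsFiniteMeasureOnCompacts Λ] {K : Set X} (hK : IsCompact K) (hΛK : Λ Kᶜ = 0)
    {h : X → F} (hh : Continuous h) [SecondCountableTopologyEither X F] : Integrable h Λ := by
  have hint := hh.continuousOn.integrableOn_compact (μ := Λ) hK
  rwa [IntegrableOn, Measure.restrict_eq_self_of_ae_mem (mem_ae_iff.2 hΛK)] at hint

theorem exists_tendsto_integral_of_measure_compl_eq_zero {ι X : Type*} [TopologicalSpace X]
    [T2Space X] [MeasurableSpace X] [BorelSpace X] (𝒰 : Ultrafilter ι) {K : Set X}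
    (hK : IsCompact K) {C : ℝ} {Λ : ι → Measure X} (hΛ : ∀ k, IsFiniteMeasure (Λ k))
    (hC : ∀ k, (Λ k).real Set.univ ≤ C) (hΛK : ∀ k, Λ k Kᶜ = 0) :
    ∃ Λ' : Measure X, IsFiniteMeasure Λ' ∧ Λ' Kᶜ = 0 ∧
      ∀ h : X → ℝ, Continuous h → Tendsto (fun k ↦ ∫ x, h x ∂(Λ k)) 𝒰 (𝓝 (∫ x, h x ∂Λ')) := by
  obtain ⟨Λ', ⟨-, hΛ'K⟩, hlim⟩ :=
    (isCompact_setOfPred_finiteMeasure_le_of_isCompact C.toNNReal hK).ultrafilter_le_nhds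
      (𝒰.map fun k ↦ ⟨Λ k, hΛ k⟩) (le_principal_iff.2 <| Ultrafilter.mem_map.2 <|
        univ_mem' fun k ↦ ⟨NNReal.coe_le_coe.1 ((hC k).trans C.le_coe_toNNReal),
          (FiniteMeasure.null_iff_toMeasure_null _ _).2 (hΛK k)⟩)
  replace hΛ'K : (Λ' : Measure X) Kᶜ = 0 := (FiniteMeasure.null_iff_toMeasure_null _ _).1 hΛ'K
  refine ⟨Λ', inferInstance, hΛ'K, fun h hh ↦ ?_⟩
  obtain ⟨M, hM⟩ := hK.exists_bound_of_continuousOn hh.continuousOn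
  obtain ⟨H, hH⟩ : ∃ H : BoundedContinuousFunction X ℝ, Set.EqOn H h K := by
    refine ⟨.ofNormedAddCommGroup (fun x ↦ max (-|M|) (min (h x) |M|)) (by fun_prop) |M| fun x ↦
      abs_le.2 ⟨le_max_left _ _, max_le (neg_le_self (abs_nonneg M)) (min_le_right _ _)⟩,
      fun x hx ↦ ?_⟩
    have hx := abs_le.1 ((hM x hx).trans (le_abs_self M))
    exact (max_eq_right (le_min hx.1 (neg_le_self (abs_nonneg M)))).trans (min_eq_left hx.2)
  have hHh : ∀ {κ : Measure X}, κ Kᶜ = 0 → ∫ x, H x ∂κ = ∫ x, h x ∂κ := fun hκ ↦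
    integral_congr_ae (mem_of_superset (mem_ae_iff.2 hκ) fun x hx ↦ hH hx)
  have hHlim := FiniteMeasure.tendsto_iff_forall_integral_tendsto.1
    (tendsto_map'_iff.1 (tendsto_id'.2 hlim)) H
  rw [hHh hΛ'K] at hHlim
  exact hHlim.congr fun k ↦ hHh (hΛK k)

end WeakLimit

section Barycenter

variable {α W : Type*} [MeasurableSpace α] [NormedAddCommGroup W] [InnerProductSpace ℝ W]
  [MeasurableSpace W] [BorelSpace W] [FiniteDimensional ℝ W]
  {Λ : Measure (α × W)} [IsFiniteMeasure Λ]

/-- The conditional expectation of the second coordinate given the first one, for a finite measure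
on a product whose second factor is a vector space. -/
noncomputable def fiberBarycenter (Λ : Measure (α × W)) [IsFiniteMeasure Λ] (x : α) : W :=
  ∫ v, v ∂(Λ.condKernel x)

theorem stronglyMeasurable_fiberBarycenter : StronglyMeasurable (fiberBarycenter Λ) :=
  stronglyMeasurable_id.integral_kernel

theorem integrable_fiberBarycenter (h : Integrable Prod.snd Λ) :
    Integrable (fiberBarycenter Λ) Λ.fst :=
  h.integral_condKernel

theorem integral_inner_fiberBarycenter (h : Integrable Prod.snd Λ) {φ : α → W}
    (hφ : Integrable (fun p ↦ inner ℝ (φ p.1) p.2) Λ) :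
    ∫ x, inner ℝ (φ x) (fiberBarycenter Λ x) ∂Λ.fst = ∫ p, inner ℝ (φ p.1) p.2 ∂Λ := by
  rw [← Measure.integral_condKernel hφ]
  exact integral_congr_ae (h.condKernel_ae.mono fun x hx ↦ (integral_inner hx (φ x)).symm)

theorem integral_comp_fiberBarycenter_le (h : Integrable Prod.snd Λ) {f : W → ℝ}
    (hf0 : ∀ v, 0 ≤ f v) (hf : ConvexOn ℝ Set.univ f) (hfi : Integrable (fun p ↦ f p.2) Λ) :
    ∫ x, f (fiberBarycenter Λ x) ∂Λ.fst ≤ ∫ p, f p.2 ∂Λ := by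
  rw [← Measure.integral_condKernel hfi]
  refine integral_mono_of_nonneg (.of_forall fun x ↦ hf0 _) hfi.integral_condKernel ?_
  filter_upwards [h.condKernel_ae, hfi.condKernel_ae] with x hx hfx
  exact hf.map_integral_le hf.locallyLipschitz.continuous.continuousOn isClosed_univ
    (.of_forall fun _ ↦ Set.mem_univ _) hx hfx

end Barycenter

section Reshetnyak

variable {ι V W : Type*} [TopologicalSpace V] [T2Space V] [MeasurableSpace V]
  [BorelSpace V] [NormedAddCommGroup W] [InnerProductSpace ℝ W] [FiniteDimensional ℝ W]
  [MeasurableSpace W] [BorelSpace W]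

/-- Reshetnyak's lower semicontinuity theorem. The limit is the fibrewise barycentre of a weak
limit of the measures `(x, σ k x)_* (μ k)`. -/
theorem exists_tendsto_integral_inner_and_integral_comp_le (𝒰 : Ultrafilter ι) {K : Set V}
    (hK : IsCompact K) {C : ℝ} {μ : ι → Measure V} (hμ : ∀ k, IsFiniteMeasure (μ k))
    (hC : ∀ k, (μ k).real Set.univ ≤ C) (hμK : ∀ k, μ k Kᶜ = 0) {σ : ι → V → W}
    (hσm : ∀ k, Measurable (σ k)) (hσ : ∀ k, ∀ᵐ x ∂(μ k), ‖σ k x‖ ≤ 1) :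
    ∃ (ω : Measure V) (b : V → W), IsFiniteMeasure ω ∧ Measurable b ∧ Integrable b ω ∧
      (∀ φ : V → W, Continuous φ → Tendsto (fun k ↦ ∫ x, inner ℝ (φ x) (σ k x) ∂(μ k)) 𝒰
        (𝓝 (∫ x, inner ℝ (φ x) (b x) ∂ω))) ∧
      ∀ f : W → ℝ, (∀ v, 0 ≤ f v) → ConvexOn ℝ Set.univ f → ∃ L,
        Tendsto (fun k ↦ ∫ x, f (σ k x) ∂(μ k)) 𝒰 (𝓝 L) ∧ ∫ x, f (b x) ∂ω ≤ L := by
  have hgraph : ∀ k, Measurable fun x ↦ (x, σ k x) := fun k ↦ measurable_id.prodMk (hσm k)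
  have hcompact : IsCompact (K ×ˢ Metric.closedBall (0 : W) 1) :=
    hK.prod (isCompact_closedBall 0 1)
  obtain ⟨Λ, hΛ, hΛK, hlim⟩ := exists_tendsto_integral_of_measure_compl_eq_zero 𝒰 hcompact
    (Λ := fun k ↦ (μ k).map fun x ↦ (x, σ k x)) (C := C) (fun k ↦ inferInstance)
    (fun k ↦ by
      rw [map_measureReal_apply (hgraph k) .univ]
      exact hC k)
    fun k ↦ by
      rw [Measure.map_apply (hgraph k) hcompact.measurableSet.compl, Set.preimage_compl,
        ← mem_ae_iff]
      filter_upwards [mem_ae_iff.2 (hμK k), hσ k] with x hxK hxσ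
      exact ⟨hxK, mem_closedBall_zero_iff.2 hxσ⟩
  have hlim_graph : ∀ h : V × W → ℝ, Continuous h →
      Tendsto (fun k ↦ ∫ x, h (x, σ k x) ∂(μ k)) 𝒰 (𝓝 (∫ p, h p ∂Λ)) := fun h hh ↦ by
    simpa only [integral_map (hgraph _).aemeasurable hh.aestronglyMeasurable] using hlim h hh
  have hsnd := integrable_of_measure_compl_eq_zero hcompact hΛK continuous_snd
  refine ⟨Λ.fst, fiberBarycenter Λ, inferInstance, stronglyMeasurable_fiberBarycenter.measurable,
    integrable_fiberBarycenter hsnd, fun φ hφ ↦ ?_, fun f hf0 hf ↦ ?_⟩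
  · have hinner : Continuous fun p : V × W ↦ inner ℝ (φ p.1) p.2 := by fun_prop
    rw [integral_inner_fiberBarycenter hsnd
      (integrable_of_measure_compl_eq_zero hcompact hΛK hinner)]
    exact hlim_graph _ hinner
  · have hcont : Continuous fun p : V × W ↦ f p.2 :=
      hf.locallyLipschitz.continuous.comp continuous_snd
    exact ⟨_, hlim_graph _ hcont, integral_comp_fiberBarycenter_le hsnd hf0 hf
      (integrable_of_measure_compl_eq_zero hcompact hΛK hcont)⟩

end Reshetnyak

section Polar

theorem norm_smul_inv_norm_smul {W : Type*} [NormedAddCommGroup W] [NormedSpace ℝ W] (v : W) :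
    ‖v‖ • ‖v‖⁻¹ • v = v := by
  obtain rfl | hv := eq_or_ne v 0
  · simp only [smul_zero]
  · exact smul_inv_smul₀ (norm_ne_zero_iff.2 hv) v

variable {α W : Type*} [MeasurableSpace α] [NormedAddCommGroup W] [MeasurableSpace W]
  [OpensMeasurableSpace W] {ω : Measure α} {b : α → W}

theorem integral_withDensity_enorm {F : Type*} [NormedAddCommGroup F] [NormedSpace ℝ F]
    (hb : Measurable b) (G : α → F) :
    ∫ x, G x ∂(ω.withDensity fun x ↦ ‖b x‖ₑ) = ∫ x, ‖b x‖ • G x ∂ω := by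
  simp only [integral_withDensity_eq_integral_toReal_smul hb.enorm
    (.of_forall fun _ ↦ enorm_lt_top), toReal_enorm]

theorem ae_withDensity_enorm_norm_inv_norm_smul [NormedSpace ℝ W] (hb : Measurable b) :
    ∀ᵐ x ∂(ω.withDensity fun x ↦ ‖b x‖ₑ), ‖‖b x‖⁻¹ • b x‖ = 1 := by
  rw [ae_withDensity_iff hb.enorm]
  exact .of_forall fun x hx ↦ norm_smul_inv_norm (𝕜 := ℝ) (enorm_ne_zero.1 hx)

end Polar

section LowerSemicontinuity

variable {n : ℕ} {f : EuclideanSpace ℝ (Fin n) → ℝ}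
  {φ b : EuclideanSpace ℝ (Fin n) → EuclideanSpace ℝ (Fin n)}
  {ω : Measure (EuclideanSpace ℝ (Fin n))} {S : Set (EuclideanSpace ℝ (Fin n))}

theorem continuous_divergence (hφ : ContDiff ℝ 1 φ) : Continuous (divergence φ) := by
  have := hφ.continuous_fderiv one_ne_zero
  unfold divergence
  fun_prop

theorem hasCompactSupport_divergence (hφ : HasCompactSupport φ) :
    HasCompactSupport (divergence φ) := by
  refine (hφ.fderiv (𝕜 := ℝ)).mono fun x hx hzero ↦ hx ?_
  simp only [divergence, hzero, zero_apply, PiLp.zero_apply, Finset.sum_const_zero]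

theorem isGaussGreen_withDensity_enorm (hb : Measurable b) (hbi : Integrable b ω)
    (h : ∀ φ : EuclideanSpace ℝ (Fin n) → EuclideanSpace ℝ (Fin n), ContDiff ℝ 1 φ →
      HasCompactSupport φ → ∫ x in S, divergence φ x = ∫ x, inner ℝ (φ x) (b x) ∂ω) :
    IsGaussGreen S (ω.withDensity fun x ↦ ‖b x‖ₑ) fun x ↦ ‖b x‖⁻¹ • b x where
  finite := isFiniteMeasure_withDensity hbi.2.ne
  measurable := hb.norm.inv.smul hb
  norm_eq_one := ae_withDensity_enorm_norm_inv_norm_smul hb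
  integral_div φ hφ hφc := by
    simp only [h φ hφ hφc, integral_withDensity_enorm hb, smul_eq_mul, ← real_inner_smul_right]
    simp only [norm_smul_inv_norm_smul]

theorem IsSurfaceTension.integral_withDensity_enorm (hf : IsSurfaceTension f)
    (hb : Measurable b) :
    ∫ x, f (‖b x‖⁻¹ • b x) ∂(ω.withDensity fun x ↦ ‖b x‖ₑ) = ∫ x, f (b x) ∂ω := by
  rw [Almgren.integral_withDensity_enorm hb]
  refine integral_congr_ae (.of_forall fun x ↦ ?_)
  obtain h0 | h0 := eq_or_ne (b x) 0
  · simp only [h0, norm_zero, zero_smul, hf.map_zero]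
  · have hpos := norm_pos_iff.2 h0
    simp only [hf.homogeneous _ _ (inv_pos.2 hpos), smul_eq_mul, mul_inv_cancel_left₀ hpos.ne']

theorem exists_tendsto_surfaceEnergy_and_le {ι : Type*} (𝒰 : Ultrafilter ι)
    (hf : IsSurfaceTension f) {B : Set (EuclideanSpace ℝ (Fin n))} (hB : Bornology.IsBounded B)
    {C : ℝ} {E : ι → Set (EuclideanSpace ℝ (Fin n))} {μ : ι → Measure (EuclideanSpace ℝ (Fin n))}
    {σ : ι → EuclideanSpace ℝ (Fin n) → EuclideanSpace ℝ (Fin n)}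
    (hE : ∀ k, IsGaussGreen (E k) (μ k) (σ k)) (hEm : ∀ k, NullMeasurableSet (E k))
    (hEB : ∀ k, E k ⊆ B) (hC : ∀ k, (μ k).real Set.univ ≤ C) (hS : NullMeasurableSet S)
    (hES : Tendsto (fun k ↦ volume (symmDiff (E k) S)) 𝒰 (𝓝 0)) :
    HasFinitePerimeter S ∧
      ∃ L, Tendsto (fun k ↦ surfaceEnergy f (E k)) 𝒰 (𝓝 L) ∧ surfaceEnergy f S ≤ L := by
  obtain ⟨ω, b, -, hb, hbi, hinner, hconvex⟩ :=
    exists_tendsto_integral_inner_and_integral_comp_le 𝒰 hB.isCompact_closure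
      (fun k ↦ (hE k).finite) hC
      (fun k ↦ measure_mono_null (Set.compl_subset_compl.2 (closure_mono (hEB k)))
        (hE k).measure_compl_closure)
      (fun k ↦ (hE k).measurable) fun k ↦ (hE k).norm_eq_one.mono fun x hx ↦ hx.le
  have hSgauss := isGaussGreen_withDensity_enorm (S := S) hb hbi fun φ hφ hφc ↦ by
    have hdiv := tendsto_setIntegral_of_tendsto_measure_symmDiff
      ((continuous_divergence hφ).integrable_of_hasCompactSupport
        (hasCompactSupport_divergence hφc)) hEm hS hES
    simp only [(hE _).integral_div φ hφ hφc] at hdiv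
    exact tendsto_nhds_unique hdiv (hinner φ hφ.continuous)
  obtain ⟨L, hL, hle⟩ := hconvex f hf.nonneg hf.convex
  refine ⟨⟨hS, (_, _), hSgauss⟩, ENNReal.ofReal L, ?_, ?_⟩
  · simp only [(hE _).surfaceEnergy_eq (hEm _) hf]
    exact ENNReal.tendsto_ofReal hL
  · rw [hSgauss.surfaceEnergy_eq hS hf, hf.integral_withDensity_enorm hb]
    exact ENNReal.ofReal_le_ofReal hle

end LowerSemicontinuity

section Minimizers

variable {n : ℕ} {f g : EuclideanSpace ℝ (Fin n) → ℝ} {E E' : Set (EuclideanSpace ℝ (Fin n))}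

theorem IsPotential.locallyIntegrable (hg : IsPotential g) : LocallyIntegrable g :=
  locallyIntegrable_iff.2 fun K hK ↦
    have : IsFiniteMeasure (volume.restrict K) := isFiniteMeasure_restrict.2 hK.measure_ne_top
    (hg.locallyBounded K hK).integrable le_top

theorem potentialEnergy_ne_top (hg : ∀ᵐ x, 0 ≤ g x) (hgE : IntegrableOn g E) :
    potentialEnergy g E ≠ ⊤ :=
  ((hasFiniteIntegral_iff_ofReal (ae_restrict_of_ae hg)).1 hgE.2).ne

theorem energyGap_eq_dist (hE : freeEnergy f g E ≠ ⊤) (hE' : freeEnergy f g E' ≠ ⊤) :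
    energyGap f g E E' = dist (freeEnergy f g E).toReal (freeEnergy f g E').toReal := by
  obtain ⟨hF, hG⟩ := ENNReal.add_ne_top.1 hE
  obtain ⟨hF', hG'⟩ := ENNReal.add_ne_top.1 hE'
  rw [energyGap, Real.dist_eq, freeEnergy, freeEnergy, ENNReal.toReal_add hF hG,
    ENNReal.toReal_add hF' hG']
  congr 1
  ring

theorem IsSurfaceTension.exists_perimeter_le (hf : IsSurfaceTension f)
    (hK : (wulffShape f).Nonempty) {C : ENNReal} (hC : C ≠ ⊤) :
    ∃ P, ∀ E, HasFinitePerimeter E → Bornology.IsBounded E → surfaceEnergy f E ≤ C →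
      (perimeterMeasure E).real Set.univ ≤ P := by
  obtain ⟨c, hc, hle⟩ := hf.exists_mul_perimeter_le hK
  refine ⟨C.toReal / c, fun E hE hEb hEC ↦ (le_div_iff₀' hc).2 ?_⟩
  rw [hE.isGaussGreen.surfaceEnergy_eq hE.1 hf] at hEC
  exact (hle E _ _ hE.isGaussGreen hEb).trans ((ENNReal.ofReal_le_iff_le_toReal hC).1 hEC)

theorem exists_tendsto_volume_symmDiff_freeEnergy_le {ι : Type*} (𝒰 : Ultrafilter ι)
    (hf : IsSurfaceTension f) (hK : (wulffShape f).Nonempty)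
    {B : Set (EuclideanSpace ℝ (Fin n))} (hB : Bornology.IsBounded B) (hBm : MeasurableSet B)
    (hgB : potentialEnergy g B ≠ ⊤) {E : ι → Set (EuclideanSpace ℝ (Fin n))}
    (hE : ∀ k, HasFinitePerimeter (E k)) (hEB : ∀ k, E k ⊆ B) {C : ENNReal} (hC : C ≠ ⊤)
    (hEC : ∀ k, freeEnergy f g (E k) ≤ C) :
    ∃ S ⊆ B, HasFinitePerimeter S ∧ Tendsto (fun k ↦ volume (symmDiff (E k) S)) 𝒰 (𝓝 0) ∧
      ∃ L, Tendsto (fun k ↦ freeEnergy f g (E k)) 𝒰 (𝓝 L) ∧ freeEnergy f g S ≤ L := by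
  obtain ⟨P, hP⟩ := hf.exists_perimeter_le hK hC
  replace hP := fun k ↦ hP (E k) (hE k) (hB.subset (hEB k)) (le_self_add.trans (hEC k))
  have hgauss := fun k ↦ (hE k).isGaussGreen
  obtain ⟨S, hSB, hSm, hES⟩ :=
    exists_tendsto_volume_symmDiff 𝒰 hB hBm hgauss (fun k ↦ (hE k).1) hEB hP
  obtain ⟨hS, L, hL, hSL⟩ := exists_tendsto_surfaceEnergy_and_le 𝒰 hf hB hgauss (fun k ↦ (hE k).1)
    hEB hP hSm.nullMeasurableSet hES
  have hG := tendsto_setLIntegral_of_tendsto_measure_symmDiff hgB hEB hSB hES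
  exact ⟨S, hSB, hS, hES, L + potentialEnergy g S, hL.add hG, add_le_add_left hSL _⟩

theorem IsMinimizer.exists_isMinimizer_tendsto_volume_symmDiff (hf : IsSurfaceTension f)
    (hK : (wulffShape f).Nonempty) {m : ℝ} {Em : Set (EuclideanSpace ℝ (Fin n))}
    (hEm : IsMinimizer f g m Em) {B : Set (EuclideanSpace ℝ (Fin n))}
    (hB : Bornology.IsBounded B) (hBm : MeasurableSet B) (hgB : potentialEnergy g B ≠ ⊤)
    {E : ℕ → Set (EuclideanSpace ℝ (Fin n))} (hE : ∀ k, HasFinitePerimeter (E k))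
    (hEB : ∀ k, E k ⊆ B) (hEv : ∀ k, volume (E k) = ENNReal.ofReal m)
    (hEtop : ∀ k, freeEnergy f g (E k) ≠ ⊤)
    (hlim : Tendsto (fun k ↦ (freeEnergy f g (E k)).toReal) atTop
      (𝓝 (freeEnergy f g Em).toReal)) :
    ∃ S, IsMinimizer f g m S ∧
      Tendsto (fun k ↦ volume.real (symmDiff S (E k))) (hyperfilter ℕ) (𝓝 0) := by
  have hEmtop := ne_top_of_le_ne_top (hEtop 0) (hEm.le (E 0) (hE 0) (hEv 0))
  obtain ⟨C, hC⟩ := hlim.bddAbove_range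
  obtain ⟨S, hSB, hS, hES, L, hL, hSL⟩ :=
    exists_tendsto_volume_symmDiff_freeEnergy_le (hyperfilter ℕ) hf hK hB hBm hgB hE hEB
      ENNReal.ofReal_ne_top fun k ↦
        (ENNReal.le_ofReal_iff_toReal_le (hEtop k) (ENNReal.toReal_nonneg.trans (hC ⟨k, rfl⟩))).2
          (hC ⟨k, rfl⟩)
  obtain rfl := tendsto_nhds_unique hL
    (((ENNReal.tendsto_toReal_iff hEtop hEmtop).1 hlim).mono_left Nat.hyperfilter_le_atTop)
  have hvolume : Tendsto (fun k ↦ volume (E k)) (hyperfilter ℕ) (𝓝 (volume S)) := by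
    have hBfin : ∫⁻ _ in B, 1 ≠ ⊤ := (setLIntegral_one B).trans_ne hB.measure_lt_top.ne
    simpa only [setLIntegral_one] using
      tendsto_setLIntegral_of_tendsto_measure_symmDiff hBfin hEB hSB hES
  simp only [hEv] at hvolume
  simp only [symmDiff_comm _ S] at hES
  exact ⟨S, ⟨hS, tendsto_nhds_unique hvolume tendsto_const_nhds,
    fun E' hE' hE'v ↦ hSL.trans (hEm.le E' hE' hE'v)⟩,
    (ENNReal.tendsto_toReal ENNReal.zero_ne_top).comp hES⟩

end Minimizers

end Almgren

theorem mainTheorem3_general {n : ℕ} {f g : EuclideanSpace ℝ (Fin n) → ℝ}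
    (hf : Almgren.IsSurfaceTension f) (hK : (Almgren.wulffShape f).Nonempty)
    (hg : ∀ᵐ x, 0 ≤ g x) (hgi : LocallyIntegrable g) {m : ℝ}
    {Em : Set (EuclideanSpace ℝ (Fin n))} (hEm : Almgren.IsMinimizer f g m Em)
    (R : ℝ) {ε : ℝ} (hε : 0 < ε) :
    ∃ w : ℝ, 0 < w ∧ ∀ E : Set (EuclideanSpace ℝ (Fin n)),
      Almgren.HasFinitePerimeter E → E ⊆ Metric.ball 0 R → volume E = ENNReal.ofReal m →
      Almgren.energyGap f g E Em < w →
      ∃ E', Almgren.IsMinimizer f g m E' ∧ volume.real (symmDiff E' E) < ε := by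
  by_contra! hcon
  choose E hE hEB hEv hgap hfar using fun k : ℕ ↦ hcon (1 / (k + 1)) Nat.one_div_pos_of_nat
  have hgB : ∀ A ⊆ Metric.ball 0 R, Almgren.potentialEnergy g A ≠ ⊤ := fun A hA ↦
    Almgren.potentialEnergy_ne_top hg ((hgi.integrableOn_isCompact
      (isCompact_closedBall 0 R)).mono_set (hA.trans Metric.ball_subset_closedBall))
  have hEtop : ∀ k, Almgren.freeEnergy f g (E k) ≠ ⊤ := fun k ↦
    ENNReal.add_ne_top.2 ⟨(hE k).surfaceEnergy_ne_top hf, hgB _ (hEB k)⟩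
  have hEmtop := ne_top_of_le_ne_top (hEtop 0) (hEm.le (E 0) (hE 0) (hEv 0))
  simp only [Almgren.energyGap_eq_dist (hEtop _) hEmtop] at hgap
  have hlim := tendsto_iff_dist_tendsto_zero.2 <| squeeze_zero (fun _ ↦ dist_nonneg)
    (fun k ↦ (hgap k).le) tendsto_one_div_add_atTop_nhds_zero_nat
  obtain ⟨S, hS, hES⟩ := hEm.exists_isMinimizer_tendsto_volume_symmDiff hf hK Metric.isBounded_ball
    measurableSet_ball (hgB _ subset_rfl) hE hEB hEv hEtop hlim
  obtain ⟨k, hk⟩ := (hES.eventually_lt_const hε).exists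
  exact (hfar k S hS).not_gt hk

theorem mainTheorem3 {n : ℕ} (f g : EuclideanSpace ℝ (Fin n) → ℝ)
    (hf : Almgren.IsSurfaceTension f) (hK : (Almgren.wulffShape f).Nonempty)
    (hg : Almgren.IsPotential g) (m : ℝ) (hm : 0 < m)
    (Em : Set (EuclideanSpace ℝ (Fin n))) (hEm : Almgren.IsMinimizer f g m Em)
    (huniq : ∀ E' : Set (EuclideanSpace ℝ (Fin n)), Almgren.IsMinimizer f g m E' →
      E' =ᵐ[MeasureTheory.volume] Em)
    (R : ℝ) (hR : 0 < R) (ε : ℝ) (hε : 0 < ε) :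
    ∃ w : ℝ, 0 < w ∧ ∀ E : Set (EuclideanSpace ℝ (Fin n)),
      Almgren.HasFinitePerimeter E → E ⊆ Metric.ball 0 R →
      MeasureTheory.volume E = ENNReal.ofReal m →
      Almgren.energyGap f g E Em < w →
      MeasureTheory.volume.real (symmDiff Em E) / MeasureTheory.volume.real Em < ε := by
  have hEmv : 0 < volume.real Em := by rwa [Measure.real, hEm.mass, ENNReal.toReal_ofReal hm.le]
  obtain ⟨w, hw, h⟩ := mainTheorem3_general hf hK hg.nonneg hg.locallyIntegrable hEm R
    (mul_pos hε hEmv)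
  refine ⟨w, hw, fun E hE hER hEv hgap ↦ (div_lt_iff₀ hEmv).2 ?_⟩
  obtain ⟨E', hE', hlt⟩ := h E hE hER hEv hgap
  rwa [← measureReal_congr ((huniq E' hE').symmDiff (ae_eq_refl E))]
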